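/- A \emph{relaxed binary tree} of size $n$ is obtained from a full binary (plane) tree with $n$ internal nodes and $n+1$ leaves as follows: the leaf that comes first in the post-order traversal is kept, and each of the other $n$ leaves is replaced by a pointer to some node (an internal node or the kept leaf) that the post-order traversal has visited before reaching that leaf. Its \emph{spine} consists of the $n$ internal nodes and the tree edges between them, and its \emph{right height} is the maximal number of right edges (edges to a right child) on a path in the spine from the root to a node of the spine ($0$ if $n=0$). Let $r_{k,n}$ be the number of relaxed binary trees of size $n$ with right height at most $k$, and let $$R_k(z)=\sum_{n\ge 0} r_{k,n}\frac{z^n}{n!}$$ be their exponential generating function, as a formal power series over $\mathbb{C}$. Let $D=\frac{d}{dz}$, let a polynomial in $z$ stand for the operator of multiplication by it, and let products of operators be compositions (so $D^2z\cdot F=(zF)''$). Define linear differential operators $(L_k)_{k\ge 0}$ by $$L_0=1-z,\qquad L_1=(1-2z)D-1,\qquad L_k=L_{k-1}\,D-L_{k-2}\,D^2z\quad(k\ge 2).$$ Then, for every $k\ge 1$, $$L_k\cdot R_k(z)=0 .$$ -/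

import Mathlib

namespace RelaxedBinaryTree

/-!
A binary tree is a `BinaryTree Unit`: the `node`s are its internal nodes and the `nil`s are the leaves of
the corresponding full binary tree.  A vertex (internal node or leaf) is addressed by the path that
leads to it from the root: `false` is an edge to the left child, `true` an edge to the right child.
-/

/-- `a` is the address of an internal node of `t`. -/
def IsInternal : BinaryTree Unit → List Bool → Prop
  | .nil, _ => False
  | .node _ _ _, [] => True
  | .node _ l _, false :: a => IsInternal l a
  | .node _ _ r, true :: a => IsInternal r a

/-- `a` is the address of a leaf of `t`. -/
def IsLeaf : BinaryTree Unit → List Bool → Prop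
  | .nil, [] => True
  | .nil, _ :: _ => False
  | .node _ _ _, [] => False
  | .node _ l _, false :: a => IsLeaf l a
  | .node _ _ r, true :: a => IsLeaf r a

/-- The addresses of all vertices of `t`, internal nodes and leaves, in post-order. -/
def postorder : BinaryTree Unit → List (List Bool)
  | .nil => [[]]
  | .node _ l r => (postorder l).map (false :: ·) ++ (postorder r).map (true :: ·) ++ [[]]

/-- In the post-order traversal of `t`, the vertex `a` is visited before the vertex `b`. -/
def VisitedBefore (t : BinaryTree Unit) (a b : List Bool) : Prop :=
  (postorder t).idxOf a < (postorder t).idxOf b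

/-- `a` is the leaf of `t` that the post-order traversal visits first. -/
def IsFirstLeaf (t : BinaryTree Unit) (a : List Bool) : Prop :=
  IsLeaf t a ∧ ∀ b, IsLeaf t b → b ≠ a → VisitedBefore t a b

/-- The right height: the maximal number of right edges on a path from the root to an internal node
of `t`, that is, to a node of the spine (it is `0` if there is no internal node). -/
noncomputable def rightHeight (t : BinaryTree Unit) : ℕ :=
  sSup {m | ∃ a, IsInternal t a ∧ m = a.count true}

/-- A relaxed binary tree: a binary tree in which the first leaf in post-order is kept and every
other leaf `a` is replaced by a pointer to a node (an internal node or the kept leaf) that has been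
visited before `a` by the post-order traversal. -/
structure RelaxedTree where
  /-- the underlying binary tree -/
  tree : BinaryTree Unit
  /-- the targets of the pointers -/
  pointer : (a : {a : List Bool // IsLeaf tree a ∧ ¬ IsFirstLeaf tree a}) →
    {b : List Bool // (IsInternal tree b ∨ IsFirstLeaf tree b) ∧ VisitedBefore tree b a.1}

/-- The number of relaxed trees with `n` internal nodes and right height at most `k`. -/
noncomputable def relaxedCount (k n : ℕ) : ℕ :=
  Nat.card {T : RelaxedTree // T.tree.numNodes = n ∧ rightHeight T.tree ≤ k}

/-- The exponential generating function of the relaxed trees of right height at most `k`. -/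
noncomputable def relaxedEGF (k : ℕ) : PowerSeries ℂ :=
  PowerSeries.mk fun n => (relaxedCount k n : ℂ) / (n.factorial : ℂ)

/-- The operator `d/dz` on power series. -/
noncomputable def opD : Module.End ℂ (PowerSeries ℂ) :=
  (PowerSeries.derivative ℂ).toLinearMap

/-- The operator of multiplication by `z`. -/
noncomputable def opZ : Module.End ℂ (PowerSeries ℂ) :=
  LinearMap.mulLeft ℂ PowerSeries.X

/-- The operators `L_k`; the product of operators is composition. -/
noncomputable def opL : ℕ → Module.End ℂ (PowerSeries ℂ)
  | 0 => 1 - opZ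
  | 1 => (1 - 2 * opZ) * opD - 1
  | k + 2 => opL (k + 1) * opD - opL k * (opD ^ 2 * opZ)

end RelaxedBinaryTree

namespace RelaxedBinaryTree

/-! A leaf has as many possible targets as there are internal nodes visited before it, plus one for
the kept leaf. If `m` internal nodes precede a subtree, its pointer choices therefore number `weight
t m`. For the trees of right depth at most k this gives an operator T_k (`transfer`), sending z^m/m!
to the exponential generating function of these weights. Cutting off the root gives D T_{k+1} = D²z
+ T_k T_{k+1} (`opD_transfer_succ`): the empty tree contributes D²z. Otherwise the left subtree acts
first, then the right one with one right edge less, and D removes the root, which is visited last.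
Composition forces T_k to be defined on all series. The L_k are built to eliminate T_k: L_0 T_1 = Dz
and L_{k+1} T_{k+2} = L_k D²z (`opL_succ_transfer`). Since R_k = T_{k+1} 1 and D²z 1 = 0, the
theorem follows. -/

open Finset

/-! ### Vertices and their order -/

/-- The set of addresses of the internal nodes of `t`. -/
def internals : BinaryTree Unit → Finset (List Bool)
  | .nil => ∅
  | .node _ l r => insert [] ((internals l).image (false :: ·) ∪ (internals r).image (true :: ·))

/-- The set of addresses of the leaves of `t`. -/
def leaves : BinaryTree Unit → Finset (List Bool)
  | .nil => {[]}
  | .node _ l r => (leaves l).image (false :: ·) ∪ (leaves r).image (true :: ·)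

/-- The address of the leftmost leaf of `t`. -/
def leftmostLeaf : BinaryTree Unit → List Bool
  | .nil => []
  | .node _ l _ => false :: leftmostLeaf l

theorem mem_internals (t : BinaryTree Unit) (a : List Bool) : a ∈ internals t ↔ IsInternal t a := by
  induction t generalizing a with
  | nil => simp [internals, IsInternal]
  | node _ l r ihl ihr =>
    rcases a with _ | ⟨_ | _, a⟩ <;> simp [internals, IsInternal, ihl, ihr]

theorem mem_leaves (t : BinaryTree Unit) (a : List Bool) : a ∈ leaves t ↔ IsLeaf t a := by
  induction t generalizing a with
  | nil => cases a <;> simp [leaves, IsLeaf]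
  | node _ l r ihl ihr =>
    rcases a with _ | ⟨_ | _, a⟩ <;> simp [leaves, IsLeaf, ihl, ihr]

theorem mem_postorder (t : BinaryTree Unit) (a : List Bool) :
    a ∈ postorder t ↔ IsInternal t a ∨ IsLeaf t a := by
  induction t generalizing a with
  | nil => cases a <;> simp [postorder, IsInternal, IsLeaf]
  | node _ l r ihl ihr =>
    rcases a with _ | ⟨_ | _, a⟩ <;> simp [postorder, IsInternal, IsLeaf, ihl, ihr]

theorem not_isLeaf_of_isInternal {t : BinaryTree Unit} {a : List Bool} (h : IsInternal t a) :
    ¬ IsLeaf t a := by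
  induction t generalizing a with
  | nil => simp [IsInternal] at h
  | node _ l r ihl ihr =>
    rcases a with _ | ⟨_ | _, a⟩
    · simp [IsLeaf]
    · exact ihl h
    · exact ihr h

theorem card_internals (t : BinaryTree Unit) : #(internals t) = t.numNodes := by
  induction t with
  | nil => rfl
  | node _ l r ihl ihr =>
    rw [internals, card_insert_of_notMem (by simp), card_union_of_disjoint,
      card_image_of_injective _ (List.cons_injective),
      card_image_of_injective _ (List.cons_injective), ihl, ihr, BinaryTree.numNodes]
    simp [disjoint_left]

theorem isLeaf_leftmostLeaf (t : BinaryTree Unit) : IsLeaf t (leftmostLeaf t) := by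
  induction t with
  | nil => trivial
  | node _ l r ihl _ => exact ihl

theorem idxOf_map_of_injective {α β : Type*} [BEq α] [LawfulBEq α] [BEq β] [LawfulBEq β]
    {f : α → β} (hf : Function.Injective f) (l : List α) (a : α) :
    (l.map f).idxOf (f a) = l.idxOf a := by
  induction l with
  | nil => rfl
  | cons b l ih =>
    have h : (f b == f a) = (b == a) := by rw [Bool.eq_iff_iff, beq_iff_eq, beq_iff_eq, hf.eq_iff]
    rw [List.map_cons, List.idxOf_cons, List.idxOf_cons, ih, h]

theorem idxOf_postorder_left {u : Unit} {l r : BinaryTree Unit} {a : List Bool}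
    (ha : a ∈ postorder l) :
    (postorder (.node u l r)).idxOf (false :: a) = (postorder l).idxOf a := by
  rw [postorder, List.append_assoc, List.idxOf_append_of_mem (by simpa using ha),
    idxOf_map_of_injective List.cons_injective]

theorem idxOf_postorder_right {u : Unit} {l r : BinaryTree Unit} {a : List Bool}
    (ha : a ∈ postorder r) :
    (postorder (.node u l r)).idxOf (true :: a) =
      (postorder l).length + (postorder r).idxOf a := by
  rw [postorder, List.append_assoc, List.idxOf_append_of_notMem (by simp),
    List.idxOf_append_of_mem (by simpa using ha), idxOf_map_of_injective List.cons_injective,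
    List.length_map]

theorem idxOf_postorder_root {u : Unit} {l r : BinaryTree Unit} :
    (postorder (.node u l r)).idxOf [] = (postorder l).length + (postorder r).length := by
  rw [postorder, List.idxOf_append_of_notMem (by simp)]
  simp

theorem idxOf_leftmostLeaf (t : BinaryTree Unit) : (postorder t).idxOf (leftmostLeaf t) = 0 := by
  induction t with
  | nil => rfl
  | node _ l r ihl _ =>
    rw [leftmostLeaf, idxOf_postorder_left ((mem_postorder _ _).2 (.inr (isLeaf_leftmostLeaf l))),
      ihl]

theorem visitedBefore_leftmostLeaf {t : BinaryTree Unit} {a : List Bool}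
    (hne : a ≠ leftmostLeaf t) : VisitedBefore t (leftmostLeaf t) a := by
  have h : (postorder t).idxOf (leftmostLeaf t) ≠ (postorder t).idxOf a := fun h =>
    hne ((List.idxOf_inj ((mem_postorder _ _).2 (.inr (isLeaf_leftmostLeaf t)))).1 h).symm
  rw [idxOf_leftmostLeaf] at h
  rw [VisitedBefore, idxOf_leftmostLeaf]
  omega

theorem isFirstLeaf_iff {t : BinaryTree Unit} {a : List Bool} :
    IsFirstLeaf t a ↔ a = leftmostLeaf t := by
  constructor
  · rintro ⟨-, h⟩
    by_contra hne
    have := h _ (isLeaf_leftmostLeaf t) (Ne.symm hne)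
    simp [VisitedBefore, idxOf_leftmostLeaf] at this
  · rintro rfl
    exact ⟨isLeaf_leftmostLeaf t, fun b _ hne => visitedBefore_leftmostLeaf hne⟩

/-! ### Counting pointers -/

open Classical in
/-- The internal nodes of `t` that are visited before `a`. -/
noncomputable def internalsBefore (t : BinaryTree Unit) (a : List Bool) : Finset (List Bool) :=
  (internals t).filter (VisitedBefore t · a)

theorem mem_internalsBefore {t : BinaryTree Unit} {a b : List Bool} :
    b ∈ internalsBefore t a ↔ IsInternal t b ∧ VisitedBefore t b a := by
  simp [internalsBefore, mem_internals]

theorem internalsBefore_leftmostLeaf (t : BinaryTree Unit) :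
    internalsBefore t (leftmostLeaf t) = ∅ := by
  ext b
  simp [mem_internalsBefore, VisitedBefore, idxOf_leftmostLeaf]

theorem internalsBefore_left {u : Unit} {l r : BinaryTree Unit} {a : List Bool}
    (ha : IsLeaf l a) :
    internalsBefore (.node u l r) (false :: a) = (internalsBefore l a).image (false :: ·) := by
  have ha' : a ∈ postorder l := (mem_postorder _ _).2 (.inr ha)
  have hlt := List.idxOf_lt_length_of_mem ha'
  ext b
  rw [mem_internalsBefore, VisitedBefore, idxOf_postorder_left ha']
  rcases b with _ | ⟨_ | _, b⟩
  · rw [idxOf_postorder_root]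
    simp
    omega
  · simp only [mem_image, List.cons.injEq, true_and, exists_eq_right, mem_internalsBefore,
      VisitedBefore, IsInternal]
    exact and_congr_right fun h => by rw [idxOf_postorder_left ((mem_postorder _ _).2 (.inl h))]
  · simp only [mem_image, List.cons.injEq, Bool.false_eq_true, false_and, and_false, exists_false,
      iff_false, IsInternal, not_and]
    intro h
    rw [idxOf_postorder_right ((mem_postorder _ _).2 (.inl h))]
    omega

theorem internalsBefore_right {u : Unit} {l r : BinaryTree Unit} {a : List Bool}
    (ha : IsLeaf r a) :
    internalsBefore (.node u l r) (true :: a) =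
      (internals l).image (false :: ·) ∪ (internalsBefore r a).image (true :: ·) := by
  have ha' : a ∈ postorder r := (mem_postorder _ _).2 (.inr ha)
  have hlt := List.idxOf_lt_length_of_mem ha'
  ext b
  rw [mem_internalsBefore, VisitedBefore, idxOf_postorder_right ha']
  rcases b with _ | ⟨_ | _, b⟩
  · rw [idxOf_postorder_root]
    simp
    omega
  · simp only [mem_union, mem_image, List.cons.injEq, true_and, exists_eq_right, mem_internals,
      IsInternal, Bool.true_eq_false, false_and, and_false, exists_false, or_false,
      and_iff_left_iff_imp]
    intro h
    have hb := (mem_postorder l b).2 (.inl h)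
    rw [idxOf_postorder_left hb]
    have := List.idxOf_lt_length_of_mem hb
    omega
  · simp only [mem_union, mem_image, List.cons.injEq, true_and, exists_eq_right,
      mem_internalsBefore, VisitedBefore, IsInternal, Bool.false_eq_true, false_and, and_false,
      exists_false, false_or]
    exact and_congr_right fun h => by
      rw [idxOf_postorder_right ((mem_postorder _ _).2 (.inl h))]
      omega

/-- The number of ways to choose the pointers of all leaves of `t` if `t` is a subtree of a larger
tree of which `m` internal nodes have been visited before `t`. -/
def weight : BinaryTree Unit → ℕ → ℕ
  | .nil, m => m + 1
  | .node _ l r, m => weight l m * weight r (m + l.numNodes)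

/-- In post-order a leaf of the right subtree comes after every internal node of the left one, but
before the root; hence the shift by `l.numNodes` and not by one more. -/
theorem prod_leaves (t : BinaryTree Unit) (m : ℕ) :
    ∏ a ∈ leaves t, (m + #(internalsBefore t a) + 1) = weight t m := by
  induction t generalizing m with
  | nil => simp [leaves, weight, internalsBefore, internals]
  | node u l r ihl ihr =>
    rw [leaves, prod_union (by simp [disjoint_left]), prod_image (by simp), prod_image (by simp),
      weight, ← ihl, ← ihr]
    congr 1
    · refine prod_congr rfl fun a ha => ?_
      rw [internalsBefore_left ((mem_leaves _ _).1 ha),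
        card_image_of_injective _ List.cons_injective]
    · refine prod_congr rfl fun a ha => ?_
      rw [internalsBefore_right ((mem_leaves _ _).1 ha),
        card_union_of_disjoint (by simp [disjoint_left]),
        card_image_of_injective _ List.cons_injective,
        card_image_of_injective _ List.cons_injective, card_internals]
      ring

/-- The choices of pointers for the leaves of `t`. -/
abbrev Pointers (t : BinaryTree Unit) : Type :=
  (a : {a : List Bool // IsLeaf t a ∧ ¬ IsFirstLeaf t a}) →
    {b : List Bool // (IsInternal t b ∨ IsFirstLeaf t b) ∧ VisitedBefore t b a.1}

theorem mem_targets {t : BinaryTree Unit} {a : List Bool} (hne : a ≠ leftmostLeaf t)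
    (b : List Bool) : b ∈ insert (leftmostLeaf t) (internalsBefore t a) ↔
      (IsInternal t b ∨ IsFirstLeaf t b) ∧ VisitedBefore t b a := by
  rw [mem_insert, mem_internalsBefore, isFirstLeaf_iff]
  constructor
  · rintro (rfl | ⟨h, h'⟩)
    · exact ⟨.inr rfl, visitedBefore_leftmostLeaf hne⟩
    · exact ⟨.inl h, h'⟩
  · rintro ⟨h | h, h'⟩
    · exact .inr ⟨h, h'⟩
    · exact .inl h

theorem card_targets {t : BinaryTree Unit} {a : List Bool} (hne : a ≠ leftmostLeaf t) :
    Nat.card {b : List Bool // (IsInternal t b ∨ IsFirstLeaf t b) ∧ VisitedBefore t b a} =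
      #(internalsBefore t a) + 1 := by
  rw [Nat.subtype_card _ (mem_targets hne), card_insert_of_notMem]
  rw [mem_internalsBefore]
  exact fun h => not_isLeaf_of_isInternal h.1 (isLeaf_leftmostLeaf t)

theorem mem_pointerLeaves {t : BinaryTree Unit} (a : List Bool) :
    a ∈ (leaves t).erase (leftmostLeaf t) ↔ IsLeaf t a ∧ ¬ IsFirstLeaf t a := by
  rw [mem_erase, mem_leaves, isFirstLeaf_iff, and_comm]

instance finite_pointers (t : BinaryTree Unit) : Finite (Pointers t) := by
  have : Finite {a : List Bool // IsLeaf t a ∧ ¬ IsFirstLeaf t a} :=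
    Finite.of_equiv _ (Equiv.subtypeEquivRight (mem_pointerLeaves (t := t)))
  have (a : {a : List Bool // IsLeaf t a ∧ ¬ IsFirstLeaf t a}) :
      Finite {b : List Bool // (IsInternal t b ∨ IsFirstLeaf t b) ∧ VisitedBefore t b a.1} :=
    Finite.of_equiv _ (Equiv.subtypeEquivRight
      (mem_targets (mt isFirstLeaf_iff.2 a.2.2)))
  exact Pi.finite

/-- The kept leaf carries no pointer, but its factor in `weight t 0` is 1, so it may be included in
the product. -/
theorem card_pointers (t : BinaryTree Unit) : Nat.card (Pointers t) = weight t 0 := by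
  have : Fintype {a : List Bool // IsLeaf t a ∧ ¬ IsFirstLeaf t a} :=
    Fintype.subtype _ mem_pointerLeaves
  rw [Nat.card_pi,
    Finset.prod_congr rfl fun a _ => card_targets (mt isFirstLeaf_iff.2 a.2.2),
    ← Finset.prod_subtype _ mem_pointerLeaves (fun a => #(internalsBefore t a) + 1),
    ← prod_leaves, ← mul_prod_erase _ _ ((mem_leaves _ _).2 (isLeaf_leftmostLeaf t))]
  simp [internalsBefore_leftmostLeaf]

/-! ### The right height -/

/-- The recursive form of the right height: it is `0` for the empty tree and `rightHeight t + 1`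
otherwise. -/
def rightDepth : BinaryTree Unit → ℕ
  | .nil => 0
  | .node _ l r => max (max 1 (rightDepth l)) (rightDepth r + 1)

theorem rightDepth_le_succ_iff (t : BinaryTree Unit) (k : ℕ) :
    rightDepth t ≤ k + 1 ↔ ∀ a, IsInternal t a → a.count true ≤ k := by
  induction t generalizing k with
  | nil => simp [rightDepth, IsInternal]
  | node _ l r ihl ihr =>
    constructor
    · intro h a ha
      simp only [rightDepth, max_le_iff] at h
      rcases a with _ | ⟨_ | _, a⟩
      · simp
      · simpa using (ihl k).1 h.1.2 a ha
      -- With no right edge allowed, `r` must be empty: `rightDepth` is at least 1 on every node.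
      · cases k with
        | zero =>
          cases r with
          | nil => simp [IsInternal] at ha
          | node => simp [rightDepth] at h
        | succ k => simpa using (ihr k).1 (by omega) a ha
    · intro h
      simp only [rightDepth, max_le_iff]
      refine ⟨⟨by omega, (ihl k).2 fun a ha => ?_⟩, ?_⟩
      · simpa using h (false :: a) ha
      · cases r with
        | nil => simp [rightDepth]
        | node u l' r' =>
          cases k with
          | zero => simpa using h [true] trivial
          | succ k =>
            have := (ihr k).2 fun a ha => by simpa using h (true :: a) ha
            omega

theorem rightHeight_le_iff (t : BinaryTree Unit) (k : ℕ) :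
    rightHeight t ≤ k ↔ rightDepth t ≤ k + 1 := by
  -- Needed because `sSup` of an unbounded set of naturals is 0.
  have hb : BddAbove {m | ∃ a, IsInternal t a ∧ m = a.count true} := by
    refine (((internals t).finite_toSet.image (·.count true)).subset ?_).bddAbove
    rintro _ ⟨a, ha, rfl⟩
    exact ⟨a, by simpa [mem_internals] using ha, rfl⟩
  rw [rightDepth_le_succ_iff]
  constructor
  · exact fun h a ha => (le_csSup hb ⟨a, ha, rfl⟩).trans h
  · intro h
    refine csSup_le' ?_
    rintro _ ⟨a, ha, rfl⟩
    exact h a ha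

/-! ### Weighted counts -/

/-- The total weight of the trees with `n` internal nodes and right depth at most `k`, if `m`
internal nodes have been visited before. -/
def weightedCount (k m n : ℕ) : ℕ :=
  ∑ t ∈ BinaryTree.treesOfNumNodesEq n with rightDepth t ≤ k, weight t m

theorem relaxedCount_eq (k n : ℕ) : relaxedCount k n = weightedCount (k + 1) 0 n := by
  let S := (BinaryTree.treesOfNumNodesEq n).filter (rightDepth · ≤ k + 1)
  have hS (t) : t ∈ S ↔ t.numNodes = n ∧ rightHeight t ≤ k := by
    simp [S, rightHeight_le_iff]
  let e : {T : RelaxedTree // T.tree.numNodes = n ∧ rightHeight T.tree ≤ k} ≃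
      Σ t : S, Pointers t.1 :=
    { toFun T := ⟨⟨T.1.tree, (hS _).2 T.2⟩, T.1.pointer⟩
      invFun p := ⟨⟨p.1.1, p.2⟩, (hS _).1 p.1.2⟩
      left_inv _ := rfl
      right_inv _ := rfl }
  rw [relaxedCount, Nat.card_congr e, Nat.card_sigma]
  simp only [card_pointers]
  exact sum_coe_sort S (fun t => weight t 0)

theorem weightedCount_zero (k m : ℕ) : weightedCount k m 0 = m + 1 := by
  simp [weightedCount, sum_filter, rightDepth, weight]

theorem weightedCount_zero_succ (m n : ℕ) : weightedCount 0 m (n + 1) = 0 := by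
  rw [weightedCount, sum_filter]
  refine sum_eq_zero fun t ht => ?_
  cases t with
  | nil => simp at ht
  | node => simp [rightDepth]

/-- Only the step to the right child lowers the depth bound. The right subtree starts after the
`p.1` internal nodes of the left one. -/
theorem weightedCount_succ_succ (k m n : ℕ) :
    weightedCount (k + 1) m (n + 1) =
      ∑ p ∈ antidiagonal n, weightedCount (k + 1) m p.1 * weightedCount k (m + p.1) p.2 := by
  rw [weightedCount, sum_filter, BinaryTree.treesOfNumNodesEq_succ, sum_biUnion]
  · refine sum_congr rfl fun p _ => ?_
    rw [sum_map, weightedCount, weightedCount, sum_filter, sum_filter, sum_mul_sum, sum_product]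
    refine sum_congr rfl fun l hl => sum_congr rfl fun r _ => ?_
    rw [BinaryTree.mem_treesOfNumNodesEq] at hl
    change (if rightDepth (.node () l r) ≤ k + 1 then weight (.node () l r) m else 0) = _
    simp only [rightDepth, weight, hl]
    split_ifs <;> first | rfl | omega
  · intro p _ q _ hpq
    simp only [Function.onFun, disjoint_left, mem_map, mem_product,
      BinaryTree.mem_treesOfNumNodesEq]
    rintro _ ⟨x, hx, rfl⟩ ⟨y, hy, h⟩
    obtain ⟨-, h₁, h₂⟩ := BinaryTree.node.inj h
    exact hpq (Prod.ext (by rw [← hx.1, ← hy.1, h₁]) (by rw [← hx.2, ← hy.2, h₂]))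

/-! ### The transfer operators -/

/-- The transfer map of the trees of right depth at most `k`: it sends `z ^ m / m!` to
`∑ n, weightedCount k m n * z ^ (m + n) / (m + n)!`. -/
noncomputable def transfer (k : ℕ) (F : PowerSeries ℂ) : PowerSeries ℂ :=
  .mk fun N => (∑ p ∈ antidiagonal N,
    p.1.factorial * PowerSeries.coeff p.1 F * weightedCount k p.1 p.2) / N.factorial

theorem factorial_mul_coeff_transfer (k N : ℕ) (F : PowerSeries ℂ) :
    N.factorial * PowerSeries.coeff N (transfer k F) = ∑ p ∈ antidiagonal N,
      p.1.factorial * PowerSeries.coeff p.1 F * weightedCount k p.1 p.2 := by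
  rw [transfer, PowerSeries.coeff_mk, mul_div_cancel₀]
  exact_mod_cast N.factorial_ne_zero

theorem relaxedEGF_eq_transfer (k : ℕ) : relaxedEGF k = transfer (k + 1) 1 := by
  ext N
  rw [relaxedEGF, transfer, PowerSeries.coeff_mk, PowerSeries.coeff_mk, relaxedCount_eq,
    sum_eq_single (0, N)]
  · simp
  · rintro ⟨i, j⟩ hp hne
    have : i ≠ 0 := by
      rintro rfl
      simp_all
    simp [PowerSeries.coeff_one, this]
  · simp

theorem ext_of_factorial_mul_coeff {F G : PowerSeries ℂ}
    (h : ∀ N : ℕ, N.factorial * PowerSeries.coeff N F = N.factorial * PowerSeries.coeff N G) :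
    F = G := by
  ext N
  exact mul_left_cancel₀ (by exact_mod_cast N.factorial_ne_zero) (h N)

theorem factorial_mul_coeff_opD (N : ℕ) (F : PowerSeries ℂ) :
    N.factorial * PowerSeries.coeff N (opD F) =
      (N + 1).factorial * PowerSeries.coeff (N + 1) F := by
  change _ * PowerSeries.coeff N (PowerSeries.derivative ℂ F) = _
  rw [PowerSeries.coeff_derivative, Nat.factorial_succ]
  push_cast
  ring

theorem coeff_opD_opZ (N : ℕ) (F : PowerSeries ℂ) :
    PowerSeries.coeff N (opD (opZ F)) = (N + 1) * PowerSeries.coeff N F := by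
  change PowerSeries.coeff N (PowerSeries.derivative ℂ (PowerSeries.X * F)) = _
  rw [PowerSeries.coeff_derivative, PowerSeries.coeff_succ_X_mul, mul_comm]

/-- Only the empty tree has depth 0, and its weight `m + 1` is the effect of Dz on z^m. -/
theorem transfer_zero (F : PowerSeries ℂ) : transfer 0 F = opD (opZ F) := by
  refine ext_of_factorial_mul_coeff fun N => ?_
  rw [factorial_mul_coeff_transfer, coeff_opD_opZ, sum_eq_single (N, 0)]
  · simp [weightedCount_zero]
    ring
  · rintro ⟨i, _ | j⟩ hp hne
    · simp_all
    · simp [weightedCount_zero_succ]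
  · simp

theorem constantCoeff_transfer (k : ℕ) (F : PowerSeries ℂ) :
    PowerSeries.constantCoeff (transfer k F) = PowerSeries.constantCoeff F := by
  rw [← PowerSeries.coeff_zero_eq_constantCoeff_apply,
    ← PowerSeries.coeff_zero_eq_constantCoeff_apply]
  simpa [weightedCount_zero] using factorial_mul_coeff_transfer k 0 F

theorem opD_transfer_succ (k : ℕ) (F : PowerSeries ℂ) :
    opD (transfer (k + 1) F) = opD (opD (opZ F)) + transfer k (transfer (k + 1) F) := by
  refine ext_of_factorial_mul_coeff fun N => ?_
  -- Splitting off the pair `(N + 1, 0)` isolates the empty tree; all other terms have a root to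
  -- remove.
  rw [map_add, mul_add, factorial_mul_coeff_opD, factorial_mul_coeff_opD, coeff_opD_opZ,
    factorial_mul_coeff_transfer, factorial_mul_coeff_transfer, Nat.sum_antidiagonal_succ',
    weightedCount_zero]
  simp only [factorial_mul_coeff_transfer, weightedCount_succ_succ]
  congr 1
  · push_cast
    ring
  · push_cast
    simp only [mul_sum, sum_mul]
    rw [sum_sigma', sum_sigma', eq_comm]
    -- Both sides run over triples: `c` nodes visited before, `d` in the left subtree, `b` in the
    -- right one. Here `a = c + d`.
    refine sum_nbij' (fun x => ⟨(x.2.1, x.2.2 + x.1.2), (x.2.2, x.1.2)⟩)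
      (fun x => ⟨(x.1.1 + x.2.1, x.2.2), (x.1.1, x.2.1)⟩) ?_ ?_ ?_ ?_ ?_
    · rintro ⟨⟨a, b⟩, c, d⟩ h
      simp at h ⊢
      omega
    · rintro ⟨⟨a, b⟩, c, d⟩ h
      simp at h ⊢
      omega
    · rintro ⟨⟨a, b⟩, c, d⟩ h
      simp at h ⊢
      obtain ⟨-, rfl⟩ := h
      simp
    · rintro ⟨⟨a, b⟩, c, d⟩ h
      simp at h ⊢
      obtain ⟨-, rfl⟩ := h
      simp
    · rintro ⟨⟨a, b⟩, c, d⟩ h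
      simp at h ⊢
      obtain ⟨-, rfl⟩ := h
      ring

/-! ### The differential operators -/

theorem opD_opZ (F : PowerSeries ℂ) : opD (opZ F) = F + opZ (opD F) := by
  change PowerSeries.derivative ℂ (PowerSeries.X * F) =
    F + PowerSeries.X * PowerSeries.derivative ℂ F
  simp [Derivation.leibniz, add_comm]

theorem opD_one : opD 1 = 0 :=
  PowerSeries.derivative_one

/-- As T_0 = Dz, the recursion is a total derivative, D((1 - z) T_1 F) = D(Dz F). It integrates
because both constant terms equal that of `F`. -/
theorem opL_zero_transfer (F : PowerSeries ℂ) : opL 0 (transfer 1 F) = opD (opZ F) := by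
  apply PowerSeries.derivative.ext
  · change opD (opL 0 (transfer 1 F)) = opD (opD (opZ F))
    have h := opD_transfer_succ 0 F
    rw [transfer_zero] at h
    simp only [opL, LinearMap.sub_apply, Module.End.one_apply, map_sub, h]
    abel
  · have h := coeff_opD_opZ 0 F
    simp only [PowerSeries.coeff_zero_eq_constantCoeff_apply] at h
    rw [h]
    simp [opL, opZ, constantCoeff_transfer]

theorem opL_succ_transfer (k : ℕ) (F : PowerSeries ℂ) :
    opL (k + 1) (transfer (k + 2) F) = opL k (opD (opD (opZ F))) := by
  induction k generalizing F with
  -- Here L_0 T_1 is Dz, not of the form L D²z, so elimination yields L_0 D - Dz = (1 - 2z)D - 1,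
  -- which is why L_1 is given separately.
  | zero =>
    have h := congrArg (opL 0) (opD_transfer_succ 1 F)
    rw [map_add, opL_zero_transfer, opD_opZ (transfer 2 F)] at h
    rw [← sub_eq_iff_eq_add] at h
    rw [← h]
    simp only [opL, two_mul, LinearMap.sub_apply, Module.End.mul_apply, Module.End.one_apply,
      LinearMap.add_apply]
    abel
  | succ k ih =>
    -- By the induction hypothesis at `transfer (k + 3) F`, L_{k+1} turns the product T_{k+2}
    -- T_{k+3} into L_k D²z T_{k+3}, exactly the term that L_{k+2} subtracts.
    have h := congrArg (opL (k + 1)) (opD_transfer_succ (k + 2) F)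
    rw [map_add, ih] at h
    rw [opL, LinearMap.sub_apply, pow_two]
    simp only [Module.End.mul_apply]
    rw [h, add_sub_cancel_right]

end RelaxedBinaryTree

theorem theorem7p4 (k : ℕ) (hk : 1 ≤ k) :
    RelaxedBinaryTree.opL k (RelaxedBinaryTree.relaxedEGF k) = 0 := by
  obtain ⟨k, rfl⟩ := Nat.exists_eq_add_of_le' hk
  rw [RelaxedBinaryTree.relaxedEGF_eq_transfer, RelaxedBinaryTree.opL_succ_transfer,
    RelaxedBinaryTree.opD_opZ, RelaxedBinaryTree.opD_one, map_zero, add_zero,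
    RelaxedBinaryTree.opD_one, map_zero]
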